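/- Let $X$ be a connected, locally path connected, paracompact Hausdorff space and let $x\in X$. For an open cover $\mathcal U$ of $X$ let $\pi(\mathcal U,x)\le\pi_1(X,x)$ be the subgroup of the classes of finite products $\prod_{j} u_j v_j u_j^{-1}$, where each $u_j$ is a path starting at $x$ and each $v_j$ is a loop lying inside some member of $\mathcal U$. The Spanier group is $\pi_1^{sp}(X,x)=\bigcap_{\mathcal U}\pi(\mathcal U,x)$, the intersection over all open covers of $X$. Let $\Lambda$ be the set of pairs $(\mathcal U,U_0)$ consisting of an open cover $\mathcal U$ of $X$ and a member $U_0\in\mathcal U$ with $x\in U_0$, such that there is a locally finite partition of unity subordinate to $\mathcal U$ whose function for $U_0$ takes the value $1$ at $x$. For such a pair let $|N(\mathcal U)|$ be the geometric realization (with the weak topology) of the nerve of $\mathcal U$, with the vertex $U_0$ as base point. If $(\mathcal V,V_0)$ refines $(\mathcal U,U_0)$, any vertex map $V\mapsto U$ with $V\subseteq U$ and $V_0\mapsto U_0$ induces the same homomorphism $\pi_1(|N(\mathcal V)|,V_0)\to\pi_1(|N(\mathcal U)|,U_0)$, and the first shape group is $$\check\pi_1(X,x)=\varprojlim_{(\mathcal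 U,U_0)\in\Lambda}\pi_1(|N(\mathcal U)|,U_0).$$ The natural homomorphism $\varphi_x:\pi_1(X,x)\to\check\pi_1(X,x)$ is induced by the maps $X\to|N(\mathcal U)|$ whose barycentric coordinates are the functions of a partition of unity as above. The space $X$ is called shape injective if $\varphi_y$ is injective for every $y\in X$. Then $\pi_1^{sp}(X,x)=1$ if and only if $\varphi_x$ is injective, and also if and only if $X$ is shape injective. -/

import Mathlib

open Set Topology

noncomputable section

universe u v

/-! ### Spanier groups -/

/-- The Spanier group `π(𝒰, x)` of a cover `𝒰`: the subgroup of `π₁(X, x)` generated by the classes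
of the loops `u * v * u⁻¹`, where `u` is a path starting at `x` and `v` is a loop inside one of the
members of `𝒰`.  The inverse of such a class is again of this form, so that the elements of the
subgroup are exactly the classes of finite products of such loops. -/
def coverSpanierGroup {X : Type u} [TopologicalSpace X] (𝒰 : Set (Set X)) (x : X) :
    Subgroup (FundamentalGroup X x) :=
  Subgroup.closure {g | ∃ U ∈ 𝒰, ∃ (y : X) (w : Path x y) (l : Path y y),
    Set.range l ⊆ U ∧
      g = FundamentalGroup.fromPath (Path.Homotopic.Quotient.mk ((w.trans l).trans w.symm))}

/-- The Spanier group `π₁^{sp}(X, x)`: the intersection of the groups `π(𝒰, x)` over all open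
covers `𝒰` of `X`. -/
def spanierGroup (X : Type u) [TopologicalSpace X] (x : X) : Subgroup (FundamentalGroup X x) :=
  ⨅ (𝒰 : Set (Set X)) (_ : (∀ U ∈ 𝒰, IsOpen U) ∧ ⋃₀ 𝒰 = univ), coverSpanierGroup 𝒰 x

/-! ### Geometric realizations -/

/-- The geometric realization `|K|` of an abstract simplicial complex: its points are given by
barycentric coordinates whose support is a face. -/
@[ext]
structure Realization {ι : Type v} (K : PreAbstractSimplicialComplex ι) where
  /-- the barycentric coordinates -/
  coord : ι →₀ ℝ
  nonneg : ∀ i, 0 ≤ coord i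
  sum_eq_one : (coord.sum fun _ r => r) = 1
  support_mem : coord.support ∈ K.faces

namespace Realization

variable {ι : Type v} {K : PreAbstractSimplicialComplex ι}

/-- Convex coordinates supported in some face define a point of the realization. -/
def ofSubset (w : ι →₀ ℝ) (h0 : ∀ i, 0 ≤ w i) (h1 : (w.sum fun _ r => r) = 1)
    (s : Finset ι) (hs : s ∈ K.faces) (hws : w.support ⊆ s) : Realization K where
  coord := w
  nonneg := h0
  sum_eq_one := h1
  support_mem := by
    refine (K.isRelLowerSet_faces hs).2 hws ?_
    rw [Finset.nonempty_iff_ne_empty]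
    intro h
    rw [Finsupp.support_eq_empty] at h
    simp [h] at h1

/-- The vertex `i` of the complex as a point of the realization. -/
def vertex (i : ι) (hi : {i} ∈ K.faces) : Realization K :=
  ofSubset (Finsupp.single i 1)
    (fun j => Finsupp.single_nonneg.2 zero_le_one j) (by simp) {i} hi
    Finsupp.support_single_subset

open Classical in
/-- Extension by zero of a point of the standard simplex on the finite set `s`. -/
def extendSimplex (s : Finset ι) (w : s → ℝ) : ι →₀ ℝ :=
  Finsupp.onFinset s (fun i => if h : i ∈ s then w ⟨i, h⟩ else 0) (by
    intro i hi
    by_contra h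
    simp [h] at hi)

theorem extendSimplex_support (s : Finset ι) (w : s → ℝ) : (extendSimplex s w).support ⊆ s :=
  Finsupp.support_onFinset_subset

open Classical in
theorem extendSimplex_apply (s : Finset ι) (w : s → ℝ) (i : ι) :
    extendSimplex s w i = if h : i ∈ s then w ⟨i, h⟩ else 0 := rfl

/-- The closed simplex of `|K|` spanned by the face `s`, parametrized by the standard simplex. -/
def ofSimplex (s : Finset ι) (hs : s ∈ K.faces) (w : stdSimplex ℝ s) : Realization K :=
  ofSubset (extendSimplex s w.1)
    (by
      intro i
      rw [extendSimplex_apply]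
      split_ifs with h
      · exact w.2.1 _
      · exact le_rfl)
    (by
      rw [Finsupp.sum_of_support_subset _ (extendSimplex_support s w.1) _ (by simp),
        ← Finset.sum_coe_sort s]
      simpa [extendSimplex_apply] using w.2.2)
    s hs (extendSimplex_support s w.1)

theorem ofSimplex_support (s : Finset ι) (hs : s ∈ K.faces) (w : stdSimplex ℝ s) :
    (ofSimplex s hs w).coord.support ⊆ s := extendSimplex_support s w.1

/-- The weak topology on `|K|`: the finest topology for which the parametrizations of all closed
simplices, which carry their usual Euclidean topology, are continuous. -/
instance : TopologicalSpace (Realization K) :=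
  ⨆ s : {s : Finset ι // s ∈ K.faces},
    TopologicalSpace.coinduced (ofSimplex s.1 s.2) inferInstance

theorem isClosed_iff {C : Set (Realization K)} :
    IsClosed C ↔ ∀ (s : Finset ι) (hs : s ∈ K.faces), IsClosed (ofSimplex s hs ⁻¹' C) := by
  rw [← isOpen_compl_iff, isOpen_iSup_iff]
  simp only [isOpen_coinduced, preimage_compl, isOpen_compl_iff, Subtype.forall]

/-- A map into `|K|` with continuous coordinates that locally meets only finitely many
vertices is continuous. -/
theorem continuous_of_locallyFinite {Y : Type*} [TopologicalSpace Y] (f : Y → Realization K)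
    (hc : ∀ i, Continuous fun y => (f y).coord i)
    (hf : ∀ y, ∃ F : Finset ι, ∀ᶠ z in 𝓝 y, (f z).coord.support ⊆ F) : Continuous f := by
  classical
  rw [continuous_iff_isClosed]
  intro C hC
  -- the part of the preimage that is supported in one face is closed
  have key : ∀ s ∈ K.faces, IsClosed {z | (f z).coord.support ⊆ s ∧ f z ∈ C} := by
    intro s hs
    have hB : IsClosed {z | (f z).coord.support ⊆ s} := by
      have : {z | (f z).coord.support ⊆ s} = ⋂ i ∈ {i | i ∉ s}, {z | (f z).coord i = 0} := by
        ext z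
        simp only [Finset.subset_iff, Finsupp.mem_support_iff, mem_ofPred_eq, mem_iInter]
        exact ⟨fun h i hi => by_contra fun h' => hi (h h'), fun h i hi => by_contra fun h' => hi (h i h')⟩
      rw [this]
      exact isClosed_biInter fun i _ => isClosed_eq (hc i) continuous_const
    let B := {z // (f z).coord.support ⊆ s}
    have hsum : ∀ z : B, ∑ i : s, (f z.1).coord i = 1 := by
      intro z
      rw [Finset.sum_coe_sort s (fun i => (f z.1).coord i),
        ← Finsupp.sum_of_support_subset (s := s) _ z.2 (fun _ r => r) (by simp)]
      exact (f z.1).sum_eq_one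
    let g : B → stdSimplex ℝ s := fun z =>
      ⟨fun i => (f z.1).coord i, fun i => (f z.1).nonneg i, hsum z⟩
    have hg : Continuous g :=
      continuous_induced_rng.2 (continuous_pi fun i => (hc i).comp continuous_subtype_val)
    have hgf : ∀ z : B, ofSimplex s hs (g z) = f z.1 := by
      intro z
      ext i
      change extendSimplex s (fun i : s => (f z.1).coord i) i = _
      rw [extendSimplex_apply]
      split_ifs with h
      · rfl
      · by_contra h'
        exact h (z.2 (Finsupp.mem_support_iff.2 (Ne.symm h')))
    have h1 : IsClosed (g ⁻¹' (ofSimplex s hs ⁻¹' C)) := (isClosed_iff.1 hC s hs).preimage hg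
    have h2 := hB.isClosedEmbedding_subtypeVal.isClosedMap _ h1
    convert h2 using 1
    ext z
    simp only [mem_ofPred_eq, mem_image, mem_preimage]
    constructor
    · rintro ⟨h, h'⟩
      exact ⟨⟨z, h⟩, by rw [hgf]; exact h', rfl⟩
    · rintro ⟨w, h, rfl⟩
      rw [hgf] at h
      exact ⟨w.2, h⟩
  rw [← isOpen_compl_iff, isOpen_iff_mem_nhds]
  intro y hy
  obtain ⟨F, hF⟩ := hf y
  let T : Finset (Finset ι) := F.powerset.filter (fun s => s ∈ K.faces)
  have hT : IsClosed (⋃ s ∈ T, {z | (f z).coord.support ⊆ s ∧ f z ∈ C}) :=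
    T.finite_toSet.isClosed_biUnion fun s hs => key s (Finset.mem_filter.1 hs).2
  have hyT : (⋃ s ∈ T, {z | (f z).coord.support ⊆ s ∧ f z ∈ C})ᶜ ∈ 𝓝 y := by
    refine hT.isOpen_compl.mem_nhds ?_
    simp only [mem_compl_iff, mem_iUnion, not_exists]
    exact fun s _ h => hy h.2
  filter_upwards [hF, hyT] with z hz hz' hzC
  refine hz' (mem_iUnion₂.2 ⟨(f z).coord.support, ?_, Finset.Subset.refl _, hzC⟩)
  exact Finset.mem_filter.2 ⟨Finset.mem_powerset.2 hz, (f z).support_mem⟩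

theorem continuous_coord (i : ι) : Continuous fun p : Realization K => p.coord i := by
  rw [continuous_iSup_dom]
  intro s
  rw [continuous_coinduced_dom]
  by_cases h : i ∈ s.1
  · have : (fun p : Realization K => p.coord i) ∘ ofSimplex s.1 s.2 =
        fun w : stdSimplex ℝ s.1 => w.1 ⟨i, h⟩ := by
      funext w
      exact dif_pos h
    rw [this]
    exact (continuous_apply _).comp continuous_subtype_val
  · have : (fun p : Realization K => p.coord i) ∘ ofSimplex s.1 s.2 = fun _ => 0 := by
      funext w
      exact dif_neg h
    rw [this]
    exact continuous_const

/-- The affine extension `|K| → |L|` of a simplicial vertex map. -/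
def simplicialMapFun {κ : Type*} {L : PreAbstractSimplicialComplex κ} (f : ι → κ)
    (hf : ∀ s ∈ K.faces, ∃ t ∈ L.faces, ∀ i ∈ s, f i ∈ t) (p : Realization K) :
    Realization L := by
  classical
  exact ofSubset (p.coord.mapDomain f)
    (by
      intro j
      rw [Finsupp.mapDomain, Finsupp.sum_apply]
      refine Finset.sum_nonneg fun i _ => ?_
      exact Finsupp.single_nonneg.2 (p.nonneg i) j)
    (by
      rw [Finsupp.sum_mapDomain_index (by simp) (by simp)]
      exact p.sum_eq_one)
    (hf _ p.support_mem).choose (hf _ p.support_mem).choose_spec.1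
    (Finsupp.mapDomain_support.trans (Finset.image_subset_iff.2
      (hf _ p.support_mem).choose_spec.2))

theorem simplicialMapFun_coord {κ : Type*} {L : PreAbstractSimplicialComplex κ} (f : ι → κ)
    (hf : ∀ s ∈ K.faces, ∃ t ∈ L.faces, ∀ i ∈ s, f i ∈ t) (p : Realization K) :
    (simplicialMapFun (L := L) f hf p).coord = p.coord.mapDomain f := rfl

/-- The affine extension of a simplicial vertex map as a continuous map. -/
def simplicialMap {κ : Type*} {L : PreAbstractSimplicialComplex κ} (f : ι → κ)
    (hf : ∀ s ∈ K.faces, ∃ t ∈ L.faces, ∀ i ∈ s, f i ∈ t) :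
    C(Realization K, Realization L) where
  toFun := simplicialMapFun f hf
  continuous_toFun := by
    classical
    refine continuous_iSup_dom.2 fun s => continuous_coinduced_dom.2 ?_
    have hsupp := ofSimplex_support s.1 s.2
    refine continuous_of_locallyFinite _ (fun j => ?_) (fun y => ⟨s.1.image f, ?_⟩)
    · have : (fun w : stdSimplex ℝ s.1 =>
          ((simplicialMapFun (L := L) f hf ∘ ofSimplex s.1 s.2) w).coord j) =
          fun w => ∑ i ∈ s.1, Finsupp.single (f i) ((ofSimplex s.1 s.2 w).coord i) j := by
        funext w
        rw [Function.comp_apply, simplicialMapFun_coord, Finsupp.mapDomain,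
          Finsupp.sum_of_support_subset _ (hsupp w) _ (by simp), Finsupp.finsetSum_apply]
      rw [this]
      refine continuous_finsetSum _ fun i _ => ?_
      have hci : Continuous fun w : stdSimplex ℝ s.1 => (ofSimplex s.1 s.2 w).coord i :=
        (continuous_coord i).comp
          (continuous_iSup_rng (i := s) continuous_coinduced_rng)
      by_cases h : f i = j
      · simpa [h] using hci
      · simpa [Finsupp.single_apply, h] using continuous_const
    · exact Filter.Eventually.of_forall fun w =>
        Finsupp.mapDomain_support.trans (Finset.image_subset_image (hsupp w))

theorem simplicialMap_vertex {κ : Type*} {L : PreAbstractSimplicialComplex κ} (f : ι → κ)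
    (hf : ∀ s ∈ K.faces, ∃ t ∈ L.faces, ∀ i ∈ s, f i ∈ t) (i : ι) (hi : {i} ∈ K.faces)
    (hj : {f i} ∈ L.faces) : simplicialMap f hf (vertex i hi) = vertex (f i) hj :=
  Realization.ext Finsupp.mapDomain_single

end Realization

/-! ### Nerves and the first shape group -/

/-- The nerve of a family `𝒰` of sets: its vertices are the members of `𝒰`, and finitely many members
span a simplex when they have a common point. -/
def nerveComplex {X : Type u} (𝒰 : Set (Set X)) : PreAbstractSimplicialComplex 𝒰 where
  faces := {s | s.Nonempty ∧ ∃ x, ∀ U ∈ s, x ∈ U.1}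
  isRelLowerSet_faces := by
    rintro s ⟨h, x, hx⟩
    exact ⟨h, fun t hts ht => ⟨ht, x, fun U hU => hx U (hts hU)⟩⟩

/-- The index set of the inverse system: open covers `𝒰` of `X` with a distinguished member `base`
containing `x`, which are normal, by a partition of unity subordinate to `𝒰` whose member
for `base` takes the value `1` at `x`. -/
structure PointedNormalCover (X : Type u) [TopologicalSpace X] (x : X) where
  sets : Set (Set X)
  isOpen : ∀ U ∈ sets, IsOpen U
  sUnion_eq : ⋃₀ sets = univ
  base : sets
  mem_base : x ∈ base.1
  exists_partition : ∃ ρ : PartitionOfUnity sets X,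
    ρ.IsSubordinate (fun U => U.1) ∧ ρ base x = 1

namespace PointedNormalCover

variable {X : Type u} [TopologicalSpace X] {x : X}

/-- The polyhedron `|N(𝒰)|`. -/
abbrev Nerve (𝒰 : PointedNormalCover X x) : Type u := Realization (nerveComplex 𝒰.sets)

theorem base_mem_faces (𝒰 : PointedNormalCover X x) : {𝒰.base} ∈ (nerveComplex 𝒰.sets).faces :=
  ⟨Finset.singleton_nonempty _, x, fun U hU => by
    rw [Finset.mem_singleton.1 hU]; exact 𝒰.mem_base⟩

/-- The base point of `|N(𝒰)|`: the vertex given by the distinguished member. -/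
def basePoint (𝒰 : PointedNormalCover X x) : 𝒰.Nerve := Realization.vertex 𝒰.base 𝒰.base_mem_faces

/-- `π₁(|N(𝒰)|, U₀)`. -/
abbrev nerveGroup (𝒰 : PointedNormalCover X x) : Type u := FundamentalGroup 𝒰.Nerve 𝒰.basePoint

/-- A projection of a pointed cover `𝒱` to a pointed cover `𝒰` which it refines: every member of `𝒱` is
sent to a member of `𝒰` containing it, and the distinguished member to the distinguished member. -/
structure Projection (𝒱 𝒰 : PointedNormalCover X x) where
  toFun : 𝒱.sets → 𝒰.sets
  subset : ∀ V, V.1 ⊆ (toFun V).1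
  map_base : toFun 𝒱.base = 𝒰.base

namespace Projection

variable {𝒱 𝒰 : PointedNormalCover X x} (p : Projection 𝒱 𝒰)

theorem simplicial : ∀ s ∈ (nerveComplex 𝒱.sets).faces, ∃ t ∈ (nerveComplex 𝒰.sets).faces,
    ∀ i ∈ s, p.toFun i ∈ t := by
  classical
  rintro s ⟨hs, y, hy⟩
  refine ⟨s.image p.toFun, ⟨hs.image _, y, ?_⟩, fun i hi => Finset.mem_image_of_mem _ hi⟩
  intro U hU
  obtain ⟨V, hV, rfl⟩ := Finset.mem_image.1 hU
  exact p.subset V (hy V hV)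

/-- The map `|N(𝒱)| → |N(𝒰)|` given by a projection. -/
def nerveMap : C(𝒱.Nerve, 𝒰.Nerve) := Realization.simplicialMap p.toFun p.simplicial

theorem nerveMap_basePoint : p.nerveMap 𝒱.basePoint = 𝒰.basePoint := by
  have h : {p.toFun 𝒱.base} ∈ (nerveComplex 𝒰.sets).faces := by
    rw [p.map_base]; exact 𝒰.base_mem_faces
  refine (Realization.simplicialMap_vertex p.toFun p.simplicial 𝒱.base 𝒱.base_mem_faces h).trans ?_
  simp only [p.map_base]
  rfl

/-- The bonding homomorphism `π₁(|N(𝒱)|, V₀) → π₁(|N(𝒰)|, U₀)`. -/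
def bonding : 𝒱.nerveGroup →* 𝒰.nerveGroup :=
  FundamentalGroup.mapOfEq p.nerveMap p.nerveMap_basePoint

end Projection

/-- A chosen partition of unity subordinate to the cover. -/
def partition (𝒰 : PointedNormalCover X x) : PartitionOfUnity 𝒰.sets X :=
  𝒰.exists_partition.choose

theorem partition_subordinate (𝒰 : PointedNormalCover X x) :
    𝒰.partition.IsSubordinate (fun U => U.1) := 𝒰.exists_partition.choose_spec.1

theorem partition_base (𝒰 : PointedNormalCover X x) : 𝒰.partition 𝒰.base x = 1 :=
  𝒰.exists_partition.choose_spec.2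

theorem mem_of_partition_ne_zero (𝒰 : PointedNormalCover X x) {U : 𝒰.sets} {y : X}
    (h : 𝒰.partition U y ≠ 0) : y ∈ U.1 :=
  𝒰.partition_subordinate U (subset_tsupport _ h)

/-- The barycentric coordinates of the image of `y` under the canonical map are the values at `y` of
the partition of unity. -/
def canonicalCoord (𝒰 : PointedNormalCover X x) (y : X) : 𝒰.sets →₀ ℝ :=
  Finsupp.onFinset (𝒰.partition.finsupport y) (fun U => 𝒰.partition U y)
    (fun _ h => (𝒰.partition.mem_finsupport y).2 h)

theorem canonicalCoord_support (𝒰 : PointedNormalCover X x) (y : X) :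
    (𝒰.canonicalCoord y).support ⊆ 𝒰.partition.finsupport y :=
  Finsupp.support_onFinset_subset

/-- The canonical map `X → |N(𝒰)|` as a function. -/
def canonicalFun (𝒰 : PointedNormalCover X x) (y : X) : 𝒰.Nerve where
  coord := 𝒰.canonicalCoord y
  nonneg U := 𝒰.partition.nonneg U y
  sum_eq_one := by
    rw [Finsupp.sum_of_support_subset _ (𝒰.canonicalCoord_support y) _ (by simp)]
    exact 𝒰.partition.sum_finsupport (mem_univ y)
  support_mem := by
    constructor
    · obtain ⟨U, hU⟩ := 𝒰.partition.exists_pos (mem_univ y)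
      exact ⟨U, Finsupp.mem_support_iff.2 hU.ne'⟩
    · exact ⟨y, fun U hU => 𝒰.mem_of_partition_ne_zero (U := U) (y := y) (Finsupp.mem_support_iff.1 hU)⟩

/-- The canonical map `X → |N(𝒰)|`. -/
def canonicalMap (𝒰 : PointedNormalCover X x) : C(X, 𝒰.Nerve) where
  toFun := 𝒰.canonicalFun
  continuous_toFun :=
    Realization.continuous_of_locallyFinite _ (fun U => (𝒰.partition U).continuous) fun y =>
      ⟨𝒰.partition.fintsupport y, (𝒰.partition.eventually_finsupport_subset y).mono
        fun z hz => (𝒰.canonicalCoord_support z).trans hz⟩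

theorem canonicalMap_coord (𝒰 : PointedNormalCover X x) (y : X) :
    (𝒰.canonicalMap y).coord = 𝒰.canonicalCoord y := rfl

theorem canonicalCoord_apply (𝒰 : PointedNormalCover X x) (y : X) (U : 𝒰.sets) :
    𝒰.canonicalCoord y U = 𝒰.partition U y := rfl

theorem canonicalMap_base (𝒰 : PointedNormalCover X x) : 𝒰.canonicalMap x = 𝒰.basePoint := by
  classical
  refine Realization.ext (Finsupp.ext fun U => ?_)
  rw [canonicalMap_coord, canonicalCoord_apply]
  change _ = Finsupp.single 𝒰.base (1 : ℝ) U
  by_cases h : 𝒰.base = U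
  · subst h
    simp [𝒰.partition_base]
  · rw [Finsupp.single_eq_of_ne (Ne.symm h)]
    have hs := 𝒰.partition.sum_finsupport' (mem_univ x)
      (I := insert 𝒰.base (insert U (𝒰.partition.finsupport x)))
      (fun _ hV => Finset.mem_insert_of_mem (Finset.mem_insert_of_mem hV))
    have hle : ∑ V ∈ ({𝒰.base, U} : Finset 𝒰.sets), 𝒰.partition V x ≤ 1 := by
      rw [← hs]
      refine Finset.sum_le_sum_of_subset_of_nonneg ?_ fun V _ _ => 𝒰.partition.nonneg V x
      intro V hV
      simp only [Finset.mem_insert, Finset.mem_singleton] at hV ⊢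
      tauto
    rw [Finset.sum_pair h, 𝒰.partition_base] at hle
    exact le_antisymm (by linarith) (𝒰.partition.nonneg U x)

/-- The homomorphism `π₁(X, x) → π₁(|N(𝒰)|, U₀)` induced by the canonical map. -/
def canonicalHom (𝒰 : PointedNormalCover X x) : FundamentalGroup X x →* 𝒰.nerveGroup :=
  FundamentalGroup.mapOfEq 𝒰.canonicalMap 𝒰.canonicalMap_base

end PointedNormalCover

namespace Realization

variable {ι : Type v} {K : PreAbstractSimplicialComplex ι}

/-- The point `(1 - t) p + t q`, for points `p` and `q` in a common closed simplex. -/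
def segment (t : unitInterval) (p q : Realization K)
    (h : ∃ s ∈ K.faces, p.coord.support ⊆ s ∧ q.coord.support ⊆ s) : Realization K := by
  classical
  exact ofSubset ((1 - (t : ℝ)) • p.coord + (t : ℝ) • q.coord)
    (fun i => by
      have h1 := mul_nonneg (sub_nonneg.2 t.2.2) (p.nonneg i)
      have h2 := mul_nonneg t.2.1 (q.nonneg i)
      simpa using add_nonneg h1 h2)
    (by
      rw [Finsupp.sum_add_index' (by simp) (by simp), Finsupp.sum_smul_index (by simp),
        Finsupp.sum_smul_index (by simp), ← Finsupp.mul_sum, ← Finsupp.mul_sum, p.sum_eq_one,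
        q.sum_eq_one]
      ring)
    h.choose h.choose_spec.1
    (Finsupp.support_add.trans (Finset.union_subset
      (Finsupp.support_smul.trans h.choose_spec.2.1)
      (Finsupp.support_smul.trans h.choose_spec.2.2)))

theorem segment_coord (t : unitInterval) (p q : Realization K)
    (h : ∃ s ∈ K.faces, p.coord.support ⊆ s ∧ q.coord.support ⊆ s) :
    (segment t p q h).coord = (1 - (t : ℝ)) • p.coord + (t : ℝ) • q.coord := rfl

end Realization

namespace PointedNormalCover

variable {X : Type u} [TopologicalSpace X] {x : X}

/-- A composite of a canonical map with a projection is homotopic, relative to the base point,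
to the canonical map. -/
theorem bonding_canonicalHom {𝒱 𝒰 : PointedNormalCover X x} (p : Projection 𝒱 𝒰)
    (g : FundamentalGroup X x) : p.bonding (𝒱.canonicalHom g) = 𝒰.canonicalHom g := by
  classical
  have hface : ∀ y : X, ∃ s ∈ (nerveComplex 𝒰.sets).faces,
      (𝒰.canonicalMap y).coord.support ⊆ s ∧
        (p.nerveMap (𝒱.canonicalMap y)).coord.support ⊆ s := by
    intro y
    refine ⟨(𝒰.canonicalMap y).coord.support ∪ (p.nerveMap (𝒱.canonicalMap y)).coord.support,
      ⟨?_, y, ?_⟩, Finset.subset_union_left, Finset.subset_union_right⟩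
    · exact ((𝒰.canonicalMap y).support_mem.1).mono Finset.subset_union_left
    · intro U hU
      rcases Finset.mem_union.1 hU with hU | hU
      · exact 𝒰.mem_of_partition_ne_zero (U := U) (y := y) (Finsupp.mem_support_iff.1 hU)
      · obtain ⟨V, hV, rfl⟩ := Finset.mem_image.1 (Finsupp.mapDomain_support hU)
        exact p.subset V (𝒱.mem_of_partition_ne_zero (U := V) (y := y) (Finsupp.mem_support_iff.1 hV))
  let H : unitInterval × X → 𝒰.Nerve := fun z =>
    Realization.segment z.1 (𝒰.canonicalMap z.2) (p.nerveMap (𝒱.canonicalMap z.2)) (hface z.2)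
  have hH : Continuous H := by
    refine Realization.continuous_of_locallyFinite _ (fun U => ?_) fun z => ?_
    · have h1 : Continuous fun y => (𝒰.canonicalMap y).coord U :=
        (Realization.continuous_coord U).comp 𝒰.canonicalMap.continuous
      have h2 : Continuous fun y => (p.nerveMap (𝒱.canonicalMap y)).coord U :=
        (Realization.continuous_coord U).comp
          (p.nerveMap.continuous.comp 𝒱.canonicalMap.continuous)
      have ht : Continuous fun z : unitInterval × X => (z.1 : ℝ) :=
        continuous_subtype_val.comp continuous_fst
      have : (fun z => (H z).coord U) = fun z : unitInterval × X =>
          (1 - (z.1 : ℝ)) * (𝒰.canonicalMap z.2).coord U +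
            (z.1 : ℝ) * (p.nerveMap (𝒱.canonicalMap z.2)).coord U := by
        funext z
        simp only [H, Realization.segment_coord, Finsupp.add_apply, Finsupp.smul_apply, smul_eq_mul]
      rw [this]
      exact ((continuous_const.sub ht).mul (h1.comp continuous_snd)).add
        (ht.mul (h2.comp continuous_snd))
    · refine ⟨𝒰.partition.fintsupport z.2 ∪ (𝒱.partition.fintsupport z.2).image p.toFun, ?_⟩
      have h1 := continuous_snd.continuousAt.eventually
        (𝒰.partition.eventually_finsupport_subset z.2)
      have h2 := continuous_snd.continuousAt.eventually
        (𝒱.partition.eventually_finsupport_subset z.2)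
      filter_upwards [h1, h2] with w hw1 hw2
      refine Finsupp.support_add.trans (Finset.union_subset_union ?_ ?_)
      · exact Finsupp.support_smul.trans ((𝒰.canonicalCoord_support w.2).trans hw1)
      · refine Finsupp.support_smul.trans (Finsupp.mapDomain_support.trans ?_)
        exact Finset.image_subset_image ((𝒱.canonicalCoord_support w.2).trans hw2)
  have hH0 : ∀ y, H (0, y) = 𝒰.canonicalMap y := fun y => by
    refine Realization.ext ?_
    simp [H, Realization.segment_coord]
  have hH1 : ∀ y, H (1, y) = p.nerveMap (𝒱.canonicalMap y) := fun y => by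
    refine Realization.ext ?_
    simp [H, Realization.segment_coord]
  have hHx : ∀ t, H (t, x) = 𝒰.basePoint := fun t => by
    refine Realization.ext ?_
    simp only [H, Realization.segment_coord, 𝒱.canonicalMap_base, p.nerveMap_basePoint,
      𝒰.canonicalMap_base, ← add_smul]
    simp
  obtain ⟨γ, rfl⟩ := Path.Homotopic.Quotient.mk_surjective g
  simp only [Projection.bonding, canonicalHom, FundamentalGroup.mapOfEq_apply]
  rw [← Path.Homotopic.Quotient.mk_map, ← Path.Homotopic.Quotient.mk_map,
    ← Path.Homotopic.Quotient.mk_cast, ← Path.Homotopic.Quotient.mk_cast,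
    ← Path.Homotopic.Quotient.mk_map, ← Path.Homotopic.Quotient.mk_cast]
  refine Path.Homotopic.Quotient.eq.2 (Path.Homotopic.symm ⟨?_⟩)
  exact
    { toFun := fun z => H (z.1, γ z.2)
      continuous_toFun := hH.comp (continuous_fst.prodMk (γ.continuous.comp continuous_snd))
      map_zero_left := fun s => hH0 _
      map_one_left := fun s => hH1 _
      prop' := fun t s hs => by
        rcases hs with rfl | hs
        · simp [hHx]
        · rw [mem_singleton_iff] at hs
          subst hs
          simp [hHx] }

end PointedNormalCover

/-- The first shape group `π̌₁(X, x)`: the inverse limit of the groups `π₁(|N(𝒰)|, U₀)` over the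
pointed normal open covers of `X` ordered by refinement, realized as the group of compatible families.
Any two projections belonging to the same refinement are contiguous, hence induce the same
bonding homomorphism. -/
def firstShapeGroup (X : Type u) [TopologicalSpace X] (x : X) :
    Subgroup (∀ 𝒰 : PointedNormalCover X x, 𝒰.nerveGroup) where
  carrier := {g | ∀ (𝒱 𝒰 : PointedNormalCover X x) (p : PointedNormalCover.Projection 𝒱 𝒰),
    p.bonding (g 𝒱) = g 𝒰}
  one_mem' := fun _ _ p => map_one p.bonding
  mul_mem' := fun {a b} ha hb 𝒱 𝒰 p => by
    rw [Pi.mul_apply, Pi.mul_apply, map_mul, ha 𝒱 𝒰 p, hb 𝒱 𝒰 p]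
  inv_mem' := fun {a} ha 𝒱 𝒰 p => by
    rw [Pi.inv_apply, Pi.inv_apply, map_inv, ha 𝒱 𝒰 p]

/-- The natural homomorphism `φ : π₁(X, x) → π̌₁(X, x)` induced by the canonical maps.  Canonical maps
for different partitions of unity are homotopic relative to the base point, so that `φ` does not
depend on the choice of partitions. -/
def shapeHom (X : Type u) [TopologicalSpace X] (x : X) :
    FundamentalGroup X x →* firstShapeGroup X x :=
  (MonoidHom.pi fun 𝒰 : PointedNormalCover X x => 𝒰.canonicalHom).codRestrict
    (firstShapeGroup X x) fun g _ _ p => PointedNormalCover.bonding_canonicalHom p g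

/-- `X` is shape injective if `π₁(X, x) → π̌₁(X, x)` is injective for every base point `x`. -/
def ShapeInjective (X : Type u) [TopologicalSpace X] : Prop :=
  ∀ x : X, Function.Injective (shapeHom X x)

end

/-!
The theorem holds because the kernel of `φ_x` is the Spanier group of `X` at `x` (`ker_shapeHom`),
and because the Spanier groups at different base points are conjugate along a path
(`spanierGroup_eq_bot_of_path`).

*The Spanier group is in the kernel.* The preimages in `X` of the open stars of `|N(𝒰)|` form an
open cover. A loop in one of them is sent by the canonical map to a loop that the straight line
homotopy contracts to a vertex (`PointedNormalCover.homotopic_refl_of_coord_pos`), hence the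
generators of the Spanier group of this cover die in `π₁(|N(𝒰)|)`.

*The kernel is in the Spanier group.* Given an open cover `𝒰`, choose a pointed normal cover `𝒱` by
path connected sets such that the union of two members that meet lies in a member of `𝒰`
(`exists_pointedNormalCover`). Modulo the normal subgroup `π(𝒰, x)`, a path inside a member of `𝒰`
depends only on its endpoints. So for each `V ∈ 𝒱` there is a class `e_V` of paths from `x` to the
points of `V`, well defined up to one choice for each `V`, and the elements `e_V * e_W⁻¹`
of `π₁(X, x) / π(𝒰, x)` for `V` and `W` that meet form a Čech cocycle. It makes sense on the open stars of
`|N(𝒱)|`, since finitely many stars have a common point exactly when the members of `𝒱` do, and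
defines a covering space of `|N(𝒱)|`. The image of a loop `α` under the canonical map has an
explicit lift, with coordinate `α|[0,s] * e_V⁻¹` at time `s` in the chart of `V`. If the image is
null-homotopic, then the lift is closed (`coord_eq_of_cocycle`), which says that the class of `α`
is in `π(𝒰, x)` (`PointedNormalCover.ker_canonicalHom_le`). No simplicial approximation in the
nerve is needed.
-/

noncomputable section

universe u

/-! ### Monodromy of a Čech cocycle -/

/-- Let `S` be an open cover of `B` and `c` a Čech cocycle on it with constant values in `Q`;
it describes a covering space of `B` with fibre `Q`. Continuous lifts of a loop `γ` to this
covering amount to families `h` of local coordinates that are compatible with `c` and locally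
constant. Lifts of a null-homotopic loop are closed, so that the coordinates of their endpoints
agree. -/
theorem coord_eq_of_cocycle {B ι Q : Type*} [TopologicalSpace B] [Group Q] {S : ι → Set B}
    (hS : ∀ i, IsOpen (S i)) (hcov : ∀ b, ∃ i, b ∈ S i) {c : ι → ι → Q}
    (hc : ∀ i j k b, b ∈ S i → b ∈ S j → b ∈ S k → c j k * c i j = c i k)
    {b : B} {γ : Path b b} (hγ : γ.Homotopic (Path.refl b)) {h : unitInterval → ι → Q}
    (hch : ∀ s i j, γ s ∈ S i → γ s ∈ S j → c i j * h s i = h s j)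
    (hloc : ∀ s i, γ s ∈ S i → ∀ᶠ t in 𝓝 s, h t i = h s i) {i : ι} (hi : b ∈ S i) :
    h 0 i = h 1 i := by
  let : TopologicalSpace Q := ⊥
  have : DiscreteTopology Q := ⟨rfl⟩
  choose ix hix using hcov
  -- the covering space given by the cocycle, as a bundle with discrete fibre
  let Z : FiberBundleCore ι B Q :=
    { baseSet := S
      isOpen_baseSet := hS
      indexAt := ix
      mem_baseSet_at := hix
      coordChange := fun i j _ q => c i j * q
      coordChange_self := fun i b hb q => by
        have h1 := hc i i i b hb hb hb
        rw [mul_eq_left.1 h1, one_mul]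
      continuousOn_coordChange := fun i j =>
        (continuous_of_discreteTopology.comp continuous_snd).continuousOn
      coordChange_comp := fun i j k b hb q => by
        rw [← mul_assoc, hc i j k b hb.1.1 hb.1.2 hb.2] }
  have cov : IsCoveringMap (Bundle.TotalSpace.proj : Bundle.TotalSpace Q Z.Fiber → B) :=
    FiberBundle.isCoveringMap
  -- the lift of `γ` whose coordinate in the chart `i` is `h s i`
  let L : unitInterval → Bundle.TotalSpace Q Z.Fiber := fun s => ⟨γ s, h s (ix (γ s))⟩
  have hL : Continuous L := by
    refine continuous_iff_continuousAt.2 fun s => ?_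
    refine (FiberBundle.continuousAt_totalSpace Q L).2 ⟨γ.continuous.continuousAt, ?_⟩
    refine continuousAt_const (y := h s (ix (γ s))) |>.congr ?_
    have hm : ∀ᶠ t in 𝓝 s, γ t ∈ S (ix (γ s)) :=
      γ.continuous.continuousAt.eventually ((hS _).mem_nhds (hix _))
    filter_upwards [hloc s _ (hix _), hm] with t ht ht'
    exact ht.symm.trans (hch t (ix (γ t)) (ix (γ s)) (hix _) ht').symm
  have h0 : γ.toContinuousMap 0 = (L 0).proj := rfl
  have h0' : (Path.refl b).toContinuousMap 0 = (L 0).proj := γ.source.symm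
  -- `L` and the constant lift are the lifts of the homotopic paths `γ` and `Path.refl b` from `L 0`
  have e1 : cov.liftPath γ.toContinuousMap (L 0) h0 1 = L 1 := by
    have := (cov.eq_liftPath_iff (γ := γ.toContinuousMap) (e := L 0) h0 (Γ := L)).2 ⟨hL, rfl, rfl⟩
    exact (congrFun this 1).symm
  have e2 : cov.liftPath (Path.refl b).toContinuousMap (L 0) h0' 1 = L 0 := by
    have := cov.liftPath_const (x := b) h0'
    exact DFunLike.congr_fun this 1
  have e3 : L 0 = L 1 := by
    exact e2.symm.trans
      ((cov.liftPath_apply_one_eq_of_homotopicRel hγ (L 0) h0 h0').symm.trans e1)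
  -- pass from the chart chosen at `b` to the chart `i`
  have e4 : h 0 (ix (γ 0)) = h 1 (ix (γ 1)) := congrArg (fun z => (z.2 : Q)) e3
  have hb : b ∈ S (ix b) := hix b
  rw [γ.source, γ.target] at e4
  have f0 := hch 0 (ix b) i (by simpa using hb) (by simpa using hi)
  have f1 := hch 1 (ix b) i (by simpa using hb) (by simpa using hi)
  rw [← f0, ← f1, e4]

/-! ### Refinements of open covers -/

/-- An open cover of a paracompact Hausdorff space has a refinement by neighbourhoods `W y` of the
points such that the union of any two members that meet lies in a member of the cover. This is a
form of the existence of barycentric star refinements. -/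
theorem exists_pairwise_refinement {X : Type*} [TopologicalSpace X] [ParacompactSpace X]
    [T2Space X] {𝒰 : Set (Set X)} (ho : ∀ U ∈ 𝒰, IsOpen U) (hcov : ⋃₀ 𝒰 = univ) :
    ∃ W : X → Set X, (∀ y, W y ∈ 𝓝 y) ∧
      ∀ y z, (W y ∩ W z).Nonempty → ∃ U ∈ 𝒰, W y ∪ W z ⊆ U := by
  obtain ⟨u, huo, huc, hlf, hu⟩ := precise_refinement (fun U : 𝒰 => U.1) (fun U => ho _ U.2)
    (by rw [← sUnion_eq_iUnion, hcov])
  obtain ⟨C, hC, hCc, hCu⟩ := exists_iUnion_eq_closed_subset huo hlf.point_finite huc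
  have hClf : LocallyFinite C := hlf.subset hCu
  -- `W y` lies in each `u i` with `y ∈ C i` and avoids the other `C i`, so that it only meets
  -- `C i` when it lies in `u i`
  let W : X → Set X := fun y => (⋂ i ∈ {i | y ∈ C i}, u i) ∩ ⋂ (i) (_ : y ∉ C i), (C i)ᶜ
  have key : ∀ y z i, z ∈ W y → z ∈ C i → W y ⊆ u i := by
    intro y z i hz hi w hw
    have hy : y ∈ C i := by
      by_contra hy
      exact mem_iInter₂.1 hz.2 i hy hi
    exact mem_iInter₂.1 hw.1 i hy
  refine ⟨W, fun y => Filter.inter_mem ?_ (hClf.iInter_compl_mem_nhds hCc y), ?_⟩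
  · exact (Filter.biInter_mem (hClf.point_finite y)).2 fun i hi => (huo i).mem_nhds (hCu i hi)
  · rintro y z ⟨w, hy, hz⟩
    obtain ⟨i, hi⟩ := mem_iUnion.1 (hC.symm ▸ mem_univ w : w ∈ ⋃ i, C i)
    exact ⟨i.1, i.2, (union_subset (key y w i hy hi) (key z w i hz hi)).trans (hu i)⟩

/-- In a locally path connected space the refinement can be chosen with path connected members and
with only one member containing `x`; the latter makes any subordinate partition of unity take the
value `1` at `x`. -/
theorem exists_pointedNormalCover {X : Type u} [TopologicalSpace X] [ParacompactSpace X]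
    [T2Space X] [LocallyPathConnectedSpace X] (x : X) {𝒰 : Set (Set X)}
    (ho : ∀ U ∈ 𝒰, IsOpen U) (hcov : ⋃₀ 𝒰 = univ) :
    ∃ 𝒱 : PointedNormalCover X x, (∀ V ∈ 𝒱.sets, IsPathConnected V) ∧
      ∀ V ∈ 𝒱.sets, ∀ W ∈ 𝒱.sets, (V ∩ W).Nonempty → ∃ U ∈ 𝒰, V ∪ W ⊆ U := by
  obtain ⟨W, hW, hWU⟩ := exists_pairwise_refinement ho hcov
  have hex : ∀ y : X, ∀ N ∈ 𝓝 y, ∃ V, IsOpen V ∧ IsPathConnected V ∧ y ∈ V ∧ V ⊆ N := by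
    intro y N hN
    obtain ⟨V, ⟨h1, h2, h3⟩, h4⟩ := (isOpen_isPathConnected_basis y).mem_iff.1 hN
    exact ⟨V, h1, h3, h2, h4⟩
  obtain ⟨V₀, ho₀, hp₀, hx₀, hs₀⟩ := hex x (W x) (hW x)
  let 𝒱 : Set (Set X) :=
    {V | IsOpen V ∧ IsPathConnected V ∧ (∃ y, V ⊆ W y) ∧ (x ∈ V → V = V₀)}
  have hV₀ : V₀ ∈ 𝒱 := ⟨ho₀, hp₀, ⟨x, hs₀⟩, fun _ => rfl⟩
  have hc : ⋃₀ 𝒱 = univ := by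
    refine eq_univ_of_forall fun y => ?_
    by_cases hy : y = x
    · subst hy
      exact ⟨V₀, hV₀, hx₀⟩
    · obtain ⟨V, h1, h2, h3, h4⟩ := hex y (W y ∩ {x}ᶜ)
        (Filter.inter_mem (hW y) (isOpen_compl_singleton.mem_nhds hy))
      exact ⟨V, ⟨h1, h2, ⟨y, h4.trans inter_subset_left⟩, fun hx => ((h4 hx).2 rfl).elim⟩, h3⟩
  obtain ⟨ρ, hρ⟩ := PartitionOfUnity.exists_isSubordinate isClosed_univ (fun V : 𝒱 => V.1)
    (fun V => V.2.1) (by rw [← sUnion_eq_iUnion, hc])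
  refine ⟨⟨𝒱, fun V hV => hV.1, hc, ⟨V₀, hV₀⟩, hx₀, ρ, hρ, ?_⟩, fun V hV => hV.2.1, ?_⟩
  · rw [← ρ.sum_eq_one (mem_univ x), finsum_eq_single _ ⟨V₀, hV₀⟩]
    intro V hV
    by_contra h
    exact hV (Subtype.ext (V.2.2.2.2 (hρ V (subset_tsupport _ h))))
  · rintro V ⟨-, -, ⟨y, hy⟩, -⟩ V' ⟨-, -, ⟨z, hz⟩, -⟩ hne
    obtain ⟨U, hU, h⟩ := hWU y z (hne.mono (inter_subset_inter hy hz))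
    exact ⟨U, hU, (union_subset_union hy hz).trans h⟩

/-! ### Path classes modulo the Spanier group of a cover -/

section

variable {X : Type*} [TopologicalSpace X] {x y z : X}

/-- A change of base point along `p` maps generators to generators: it replaces the approach path
`w` by `p⁻¹ * w`. -/
theorem map_fundamentalGroupMulEquivOfPath_le (𝒰 : Set (Set X)) (p : Path y x) :
    (coverSpanierGroup 𝒰 y).map (FundamentalGroup.fundamentalGroupMulEquivOfPath p).toMonoidHom ≤
      coverSpanierGroup 𝒰 x := by
  rw [coverSpanierGroup, MonoidHom.map_closure, Subgroup.closure_le]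
  rintro _ ⟨_, ⟨U, hU, z, w, l, hl, rfl⟩, rfl⟩
  refine Subgroup.subset_closure ⟨U, hU, z, p.symm.trans w, l, hl, ?_⟩
  change (Path.Homotopic.Quotient.mk p).symm.trans
    ((Path.Homotopic.Quotient.mk _).trans (Path.Homotopic.Quotient.mk p)) = _
  simp only [Path.trans_symm, Path.symm_symm, Path.Homotopic.Quotient.mk_trans,
    Path.Homotopic.Quotient.mk_symm, Path.Homotopic.Quotient.trans_assoc]

instance coverSpanierGroup_normal (𝒰 : Set (Set X)) : (coverSpanierGroup 𝒰 x).Normal := by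
  refine ⟨fun n hn g => ?_⟩
  obtain ⟨p, rfl⟩ := Path.Homotopic.Quotient.mk_surjective g
  exact map_fundamentalGroupMulEquivOfPath_le 𝒰 p (Subgroup.mem_map_of_mem _ hn)

theorem spanierGroup_eq_bot_of_path (p : Path y x) (h : spanierGroup X x = ⊥) :
    spanierGroup X y = ⊥ := by
  refine (Subgroup.eq_bot_iff_forall _).2 fun g hg => ?_
  have h1 : FundamentalGroup.fundamentalGroupMulEquivOfPath p g ∈ spanierGroup X x := by
    simp only [spanierGroup, Subgroup.mem_iInf] at hg ⊢
    exact fun 𝒰 h𝒰 =>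
      map_fundamentalGroupMulEquivOfPath_le 𝒰 p (Subgroup.mem_map_of_mem _ (hg 𝒰 h𝒰))
  rwa [h, Subgroup.mem_bot, EmbeddingLike.map_eq_one_iff] at h1

/-- The class modulo `N` of the loop `a * b⁻¹`, for two path classes from `x` to `y`. It is trivial
when `a` and `b` are the same path class up to left multiplication by an element of `N`. -/
def pathDiff (N : Subgroup (FundamentalGroup X x)) (a b : Path.Homotopic.Quotient x y) :
    FundamentalGroup X x ⧸ N :=
  (FundamentalGroup.fromPath (a.trans b.symm) : FundamentalGroup X x)

/-- The factors appear in reverse order because the product `p * q` in `FundamentalGroup` runs first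
along `q`. -/
theorem pathDiff_mul (N : Subgroup (FundamentalGroup X x)) [N.Normal]
    (a b c : Path.Homotopic.Quotient x y) :
    pathDiff N b c * pathDiff N a b = pathDiff N a c := by
  refine congrArg (QuotientGroup.mk (s := N)) ?_
  change (a.trans b.symm).trans (b.trans c.symm) = a.trans c.symm
  rw [Path.Homotopic.Quotient.trans_assoc, ← Path.Homotopic.Quotient.trans_assoc b.symm,
    Path.Homotopic.Quotient.symm_trans, Path.Homotopic.Quotient.refl_trans]

theorem pathDiff_self (N : Subgroup (FundamentalGroup X x)) [N.Normal]
    (a : Path.Homotopic.Quotient x y) : pathDiff N a a = 1 :=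
  mul_eq_left.1 (pathDiff_mul N a a a)

theorem pathDiff_trans_trans (N : Subgroup (FundamentalGroup X x))
    (a b : Path.Homotopic.Quotient x y) (p : Path.Homotopic.Quotient y z) :
    pathDiff N (a.trans p) (b.trans p) = pathDiff N a b := by
  refine congrArg (QuotientGroup.mk (s := N)) ?_
  change (a.trans p).trans (b.trans p).symm = a.trans b.symm
  obtain ⟨b, rfl⟩ := Path.Homotopic.Quotient.mk_surjective b
  obtain ⟨p, rfl⟩ := Path.Homotopic.Quotient.mk_surjective p
  rw [← Path.Homotopic.Quotient.mk_trans, ← Path.Homotopic.Quotient.mk_symm, Path.trans_symm,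
    Path.Homotopic.Quotient.mk_trans, Path.Homotopic.Quotient.trans_assoc,
    ← Path.Homotopic.Quotient.trans_assoc (Path.Homotopic.Quotient.mk p),
    Path.Homotopic.Quotient.mk_symm, Path.Homotopic.Quotient.trans_symm,
    Path.Homotopic.Quotient.refl_trans, Path.Homotopic.Quotient.mk_symm]

theorem pathDiff_congr {N : Subgroup (FundamentalGroup X x)} [N.Normal]
    {a a' b b' : Path.Homotopic.Quotient x y} (ha : pathDiff N a a' = 1)
    (hb : pathDiff N b b' = 1) : pathDiff N a b = pathDiff N a' b' := by
  rw [← pathDiff_mul N a a' b, ha, mul_one, ← pathDiff_mul N a' b b', hb, one_mul]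

open Path.Homotopic.Quotient in
/-- Modulo `π(𝒰, x)`, a path inside a member of `𝒰` depends only on its endpoints. -/
theorem pathDiff_trans_of_subset {𝒰 : Set (Set X)} {U : Set X} (hU : U ∈ 𝒰)
    (a : Path.Homotopic.Quotient x y) (p q : Path y z) (hp : range p ⊆ U) (hq : range q ⊆ U) :
    pathDiff (coverSpanierGroup 𝒰 x) (a.trans (mk p)) (a.trans (mk q)) = 1 := by
  refine (QuotientGroup.eq_one_iff _).2 (Subgroup.subset_closure ?_)
  obtain ⟨w, rfl⟩ := mk_surjective a
  refine ⟨U, hU, y, w, p.trans q.symm, ?_, ?_⟩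
  · rw [Path.trans_range, Path.symm_range]
    exact union_subset hp hq
  · change ((mk w).trans (mk p)).trans ((mk w).trans (mk q)).symm = _
    simp only [← mk_trans, ← mk_symm, Path.trans_symm]
    simp only [mk_trans, mk_symm, trans_assoc]

/-- For `V` path connected inside a member of `𝒰`, there is a path class from `x` to each point of
`V` which is transported, modulo `π(𝒰, x)`, along every path in `V`. The values of `e` outside `V`
carry no information. -/
theorem exists_pathClass_of_isPathConnected [PathConnectedSpace X] {𝒰 : Set (Set X)} {U V : Set X}
    (hU : U ∈ 𝒰) (hVU : V ⊆ U) (hV : IsPathConnected V) :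
    ∃ e : ∀ y : X, Path.Homotopic.Quotient x y, ∀ (y z : X) (p : Path y z), range p ⊆ V →
      pathDiff (coverSpanierGroup 𝒰 x) ((e y).trans (Path.Homotopic.Quotient.mk p)) (e z) = 1 := by
  classical
  obtain ⟨v, hv, hj⟩ := hV
  let w := PathConnectedSpace.somePath x v
  let q : ∀ y, Path v y := fun y =>
    if h : y ∈ V then (hj h).somePath else PathConnectedSpace.somePath v y
  have hq : ∀ y ∈ V, range (q y) ⊆ V := by
    rintro y hy _ ⟨t, rfl⟩
    simp only [q, dif_pos hy]
    exact (hj hy).somePath_mem t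
  refine ⟨fun y => (Path.Homotopic.Quotient.mk w).trans (Path.Homotopic.Quotient.mk (q y)),
    fun y z p hp => ?_⟩
  have hy : y ∈ V := hp ⟨0, p.source⟩
  have hz : z ∈ V := hp ⟨1, p.target⟩
  rw [Path.Homotopic.Quotient.trans_assoc, ← Path.Homotopic.Quotient.mk_trans]
  refine pathDiff_trans_of_subset hU _ _ _ ?_ ((hq z hz).trans hVU)
  rw [Path.trans_range]
  exact (union_subset (hq y hy) hp).trans hVU

end

/-! ### Initial segments of a path -/

instance unitInterval.instContractibleSpace : ContractibleSpace unitInterval :=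
  (convex_Icc (0 : ℝ) 1).contractibleSpace ⟨0, left_mem_Icc.2 zero_le_one⟩

instance unitInterval.instLocallyPathConnectedSpace : LocallyPathConnectedSpace unitInterval := by
  refine .of_bases (fun s => Metric.nhds_basis_ball (x := s)) fun s ε hε => ?_
  refine (IsInducing.subtypeVal.isPathConnected_iff).2 ?_
  have h : Subtype.val '' Metric.ball s ε = Icc (0 : ℝ) 1 ∩ Metric.ball (s : ℝ) ε := by
    rw [← Subtype.image_preimage_coe]
    rfl
  rw [h]
  exact ((convex_Icc 0 1).inter (convex_ball _ _)).isPathConnected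
    ⟨s, s.2, Metric.mem_ball_self hε⟩

open Path.Homotopic.Quotient in
/-- The classes `A s` of the initial segments of a path, characterized by their behaviour under
extension along the path. -/
theorem exists_initialSegment {X : Type*} [TopologicalSpace X] {x y : X} (α : Path x y) :
    ∃ A : ∀ s, Path.Homotopic.Quotient x (α s),
      (∀ (s t : unitInterval) (p : Path s t), (A s).trans (mk (p.map α.continuous)) = A t) ∧
        A 0 = (Path.Homotopic.Quotient.refl x).cast rfl α.source ∧
        A 1 = (mk α).cast rfl α.target := by
  -- all paths in the interval with the same endpoints are homotopic
  refine ⟨fun s => (map (mk (PathConnectedSpace.somePath 0 s)) α.toContinuousMap).cast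
    α.source.symm rfl, fun s t p => ?_, ?_, ?_⟩
  · have h : (mk (PathConnectedSpace.somePath 0 s)).trans (mk p) =
        mk (PathConnectedSpace.somePath 0 t) := Subsingleton.elim _ _
    beta_reduce
    rw [← h]
    simp only [← mk_trans, ← mk_map, ← mk_cast]
    congr 1
    ext r
    simp only [Path.trans_apply, Path.map_coe, Path.cast_coe, Function.comp]
    split_ifs <;> rfl
  · have h : mk (PathConnectedSpace.somePath (0 : unitInterval) 0) = mk (Path.refl _) :=
      Subsingleton.elim _ _
    beta_reduce
    rw [h]
    simp only [← mk_refl, ← mk_map, ← mk_cast]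
    congr 1
    ext r
    simp
  · have h : mk (PathConnectedSpace.somePath (0 : unitInterval) 1) = mk unitInterval.path01 :=
      Subsingleton.elim _ _
    beta_reduce
    rw [h]
    simp only [← mk_map, ← mk_cast]
    rfl

/-! ### Kernels of the canonical homomorphisms -/

namespace PointedNormalCover

variable {X : Type u} [TopologicalSpace X] {x : X}

open Path.Homotopic.Quotient in
theorem canonicalHom_mk_eq_one_iff (𝒱 : PointedNormalCover X x) (α : Path x x) :
    𝒱.canonicalHom (FundamentalGroup.fromPath (Path.Homotopic.Quotient.mk α)) = 1 ↔
      ((α.map 𝒱.canonicalMap.continuous).cast 𝒱.canonicalMap_base.symm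
        𝒱.canonicalMap_base.symm).Homotopic (Path.refl 𝒱.basePoint) := by
  rw [canonicalHom, FundamentalGroup.mapOfEq_apply, FundamentalGroup.one_def, ← mk_map, ← mk_cast,
    ← mk_refl, Path.Homotopic.Quotient.eq]

theorem mem_of_coord_pos (𝒱 : PointedNormalCover X x) {y : X} {V : 𝒱.sets}
    (h : 0 < (𝒱.canonicalMap y).coord V) : y ∈ V.1 :=
  𝒱.mem_of_partition_ne_zero (U := V) (y := y) h.ne'

open Path.Homotopic.Quotient in
/-- The canonical map sends a loop on which the coordinate of `U` is positive to a
null-homotopic loop, by the straight line contraction to the vertex `U`. -/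
theorem homotopic_refl_of_coord_pos (𝒰 : PointedNormalCover X x) (U : 𝒰.sets) {y : X}
    (l : Path y y) (hl : ∀ t, 0 < (𝒰.canonicalMap (l t)).coord U) :
    (l.map 𝒰.canonicalMap.continuous).Homotopic (Path.refl (𝒰.canonicalMap y)) := by
  classical
  let S := {z : X // 0 < (𝒰.canonicalMap z).coord U}
  let f : C(S, 𝒰.Nerve) := 𝒰.canonicalMap.comp ⟨Subtype.val, continuous_subtype_val⟩
  have hU : {U} ∈ (nerveComplex 𝒰.sets).faces :=
    ⟨Finset.singleton_nonempty _, y, fun V hV => by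
      rw [Finset.mem_singleton.1 hV]
      exact 𝒰.mem_of_coord_pos (by simpa using hl 0)⟩
  have hface : ∀ z : S, ∃ s ∈ (nerveComplex 𝒰.sets).faces,
      (f z).coord.support ⊆ s ∧ (Realization.vertex U hU).coord.support ⊆ s := fun z =>
    ⟨_, (f z).support_mem, subset_rfl, Finsupp.support_single_subset.trans
      (Finset.singleton_subset_iff.2 (Finsupp.mem_support_iff.2 z.2.ne'))⟩
  -- on `S` the canonical map is homotopic to a constant; as the partition of unity is locally
  -- finite, continuity of the homotopy can be checked on coordinates
  let F : f.Homotopy (ContinuousMap.const S (Realization.vertex U hU)) :=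
    { toFun := fun z => Realization.segment z.1 (f z.2) (Realization.vertex U hU) (hface z.2)
      continuous_toFun := by
        refine Realization.continuous_of_locallyFinite _ (fun V => ?_) fun z => ?_
        · simp only [Realization.segment_coord, Finsupp.add_apply, Finsupp.smul_apply, smul_eq_mul]
          have h1 := (Realization.continuous_coord V).comp (f.continuous.comp
            (continuous_snd (X := unitInterval)))
          have ht : Continuous fun z : unitInterval × S => (z.1 : ℝ) :=
            continuous_subtype_val.comp continuous_fst
          exact ((continuous_const.sub ht).mul h1).add (ht.mul continuous_const)
        · refine ⟨𝒰.partition.fintsupport z.2.1 ∪ {U}, ?_⟩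
          have h1 := (continuous_subtype_val.comp (continuous_snd (X := unitInterval)
            (Y := S))).continuousAt.eventually (𝒰.partition.eventually_finsupport_subset z.2.1)
          filter_upwards [h1] with w hw
          refine Finsupp.support_add.trans (Finset.union_subset_union ?_ ?_)
          · exact Finsupp.support_smul.trans ((𝒰.canonicalCoord_support w.2.1).trans hw)
          · exact Finsupp.support_smul.trans Finsupp.support_single_subset
      map_zero_left := fun z => Realization.ext (by simp [Realization.segment_coord])
      map_one_left := fun z => Realization.ext (by simp [Realization.segment_coord]) }
  let y' : S := ⟨y, by simpa using hl 0⟩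
  let l' : Path y' y' :=
    { toFun := fun t => ⟨l t, hl t⟩
      continuous_toFun := by fun_prop
      source' := Subtype.ext l.source
      target' := Subtype.ext l.target }
  -- naturality along the track of the base point, which then cancels
  have h := Path.Homotopic.map_trans_evalAt F l'
  have hconst : l'.map (map_continuous (ContinuousMap.const S (Realization.vertex U hU))) =
      Path.refl _ := rfl
  rw [hconst, ← Path.Homotopic.Quotient.eq, mk_trans, mk_trans, mk_refl, trans_refl] at h
  have h2 := congrArg (fun a => a.trans (Path.Homotopic.Quotient.mk (F.evalAt y')).symm) h
  simp only [trans_assoc, trans_symm, trans_refl] at h2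
  exact Path.Homotopic.Quotient.eq.1 h2

open Path.Homotopic.Quotient in
theorem spanierGroup_le_ker_canonicalHom (𝒰 : PointedNormalCover X x) :
    spanierGroup X x ≤ 𝒰.canonicalHom.ker := by
  -- the cover of `X` by the preimages of the open stars
  have hle : coverSpanierGroup (range fun U : 𝒰.sets => {y | 0 < (𝒰.canonicalMap y).coord U}) x ≤
      𝒰.canonicalHom.ker := by
    rw [coverSpanierGroup, Subgroup.closure_le]
    rintro _ ⟨_, ⟨U, rfl⟩, y, w, l, hl, rfl⟩
    have h := 𝒰.homotopic_refl_of_coord_pos U l (fun t => hl ⟨t, rfl⟩)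
    change 𝒰.canonicalHom _ = 1
    rw [canonicalHom_mk_eq_one_iff, ← Path.Homotopic.Quotient.eq, mk_cast, Path.map_trans,
      Path.map_trans, mk_trans, mk_trans, Path.Homotopic.Quotient.eq.2 h, mk_refl, trans_refl,
      ← Path.map_symm, mk_symm, trans_symm, ← mk_refl, ← mk_cast]
    congr 1
    ext t
    simp [𝒰.canonicalMap_base]
  refine le_trans (iInf₂_le _ ⟨?_, ?_⟩) hle
  · rintro _ ⟨U, rfl⟩
    exact isOpen_lt continuous_const
      ((Realization.continuous_coord U).comp 𝒰.canonicalMap.continuous)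
  · refine eq_univ_of_forall fun y => ?_
    obtain ⟨U, hU⟩ := 𝒰.partition.exists_pos (mem_univ y)
    exact ⟨_, ⟨U, rfl⟩, hU⟩

open Path.Homotopic.Quotient in
/-- For a cover `𝒱` by path connected sets such that the union of two members that meet lies in a
member of `𝒰`, the canonical map of `𝒱` determines a loop up to `π(𝒰, x)`. -/
theorem ker_canonicalHom_le [PathConnectedSpace X] (𝒱 : PointedNormalCover X x) {𝒰 : Set (Set X)}
    (hpc : ∀ V ∈ 𝒱.sets, IsPathConnected V)
    (hun : ∀ V ∈ 𝒱.sets, ∀ W ∈ 𝒱.sets, (V ∩ W).Nonempty → ∃ U ∈ 𝒰, V ∪ W ⊆ U) :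
    𝒱.canonicalHom.ker ≤ coverSpanierGroup 𝒰 x := by
  classical
  intro g hg
  obtain ⟨α, rfl⟩ := mk_surjective g
  have hγ := (𝒱.canonicalHom_mk_eq_one_iff α).1 hg
  let N := coverSpanierGroup 𝒰 x
  have he : ∀ V : 𝒱.sets, ∃ e : ∀ y : X, Path.Homotopic.Quotient x y,
      ∀ (y z : X) (p : Path y z), range p ⊆ V.1 →
        pathDiff N ((e y).trans (Path.Homotopic.Quotient.mk p)) (e z) = 1 := by
    intro V
    obtain ⟨U, hU, hVU⟩ := hun V V.2 V V.2 (by rw [inter_self]; exact (hpc V V.2).nonempty)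
    exact exists_pathClass_of_isPathConnected hU (subset_union_left.trans hVU) (hpc V V.2)
  choose e he using he
  -- the cocycle `e V * (e W)⁻¹` on the open stars of the nerve
  let c : 𝒱.sets → 𝒱.sets → FundamentalGroup X x ⧸ N := fun V W =>
    if h : (V.1 ∩ W.1).Nonempty then pathDiff N (e V h.some) (e W h.some) else 1
  -- it does not depend on the point of `V ∩ W`
  have hcdef : ∀ (V W : 𝒱.sets) (y : X), y ∈ V.1 → y ∈ W.1 →
      c V W = pathDiff N (e V y) (e W y) := by
    intro V W y hV hW
    have h : (V.1 ∩ W.1).Nonempty := ⟨y, hV, hW⟩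
    obtain ⟨U, hU, hVWU⟩ := hun V V.2 W W.2 h
    obtain ⟨p, hp⟩ : JoinedIn V.1 h.some y := (hpc V V.2).joinedIn _ h.some_mem.1 _ hV
    obtain ⟨q, hq⟩ : JoinedIn W.1 h.some y := (hpc W W.2).joinedIn _ h.some_mem.2 _ hW
    rw [← range_subset_iff] at hp hq
    have h1 := pathDiff_trans_of_subset hU (e W h.some) p q
      (hp.trans (subset_union_left.trans hVWU)) (hq.trans (subset_union_right.trans hVWU))
    have h2 := pathDiff_mul N ((e W h.some).trans (Path.Homotopic.Quotient.mk p))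
      ((e W h.some).trans (Path.Homotopic.Quotient.mk q)) (e W y)
    rw [h1, mul_one, he W _ _ q hq] at h2
    simp only [c, dif_pos h]
    rw [← pathDiff_trans_trans N _ _ (Path.Homotopic.Quotient.mk p)]
    exact pathDiff_congr (he V _ _ p hp) h2.symm
  obtain ⟨A, hA, hA0, hA1⟩ := exists_initialSegment α
  have hAcast : ∀ (y : X) (h : y = x) (a : Path.Homotopic.Quotient x x) (V : 𝒱.sets),
      pathDiff N (a.cast rfl h) (e V y) = pathDiff N a (e V x) := by
    rintro y rfl a V
    rw [cast_rfl_rfl]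
  obtain ⟨V, hV⟩ : ∃ V, 0 < (𝒱.basePoint).coord V := ⟨𝒱.base, by
    change 0 < Finsupp.single 𝒱.base (1 : ℝ) 𝒱.base
    simp⟩
  -- `A s * (e V (α s))⁻¹` are the coordinates of a lift of the image of `α` in the nerve
  have key := coord_eq_of_cocycle (S := fun V => {b : 𝒱.Nerve | 0 < b.coord V}) (c := c)
    (h := fun s V => pathDiff N (A s) (e V (α s)))
    (fun V => isOpen_lt continuous_const (Realization.continuous_coord V))
    (fun b => by
      obtain ⟨V, hV⟩ := b.support_mem.1
      exact ⟨V, (b.nonneg V).lt_of_ne' (Finsupp.mem_support_iff.1 hV)⟩)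
    (fun V₁ V₂ V₃ b h₁ h₂ h₃ => by
      obtain ⟨y, hy⟩ := b.support_mem.2
      have hm : ∀ V, 0 < b.coord V → y ∈ V.1 := fun V h => hy V (Finsupp.mem_support_iff.2 h.ne')
      rw [hcdef V₁ V₂ y (hm _ h₁) (hm _ h₂), hcdef V₂ V₃ y (hm _ h₂) (hm _ h₃),
        hcdef V₁ V₃ y (hm _ h₁) (hm _ h₃), pathDiff_mul])
    hγ
    (fun s V W hV hW => by
      rw [hcdef V W (α s) (𝒱.mem_of_coord_pos hV) (𝒱.mem_of_coord_pos hW), pathDiff_mul])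
    (fun s V hV => by
      have hs : α ⁻¹' V.1 ∈ 𝓝 s :=
        α.continuous.continuousAt.preimage_mem_nhds
          ((𝒱.isOpen V V.2).mem_nhds (𝒱.mem_of_coord_pos hV))
      obtain ⟨J, ⟨hJ, hsJ, hJp⟩, hJV⟩ := (isOpen_isPathConnected_basis s).mem_iff.1 hs
      filter_upwards [hJ.mem_nhds hsJ] with t ht
      obtain ⟨p, hp⟩ := hJp.joinedIn s hsJ t ht
      have hpV : range (p.map α.continuous) ⊆ V.1 := by
        rintro _ ⟨r, rfl⟩
        exact hJV (hp r)
      rw [← hA s t p, ← pathDiff_congr (pathDiff_self N _) (he V _ _ _ hpV), pathDiff_trans_trans])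
    hV
  rw [hA0, hA1, hAcast, hAcast] at key
  have h1 : pathDiff N (Path.Homotopic.Quotient.mk α) (Path.Homotopic.Quotient.refl x) = 1 := by
    rw [← pathDiff_mul N _ (e V x), ← key, pathDiff_mul, pathDiff_self]
  have h2 := (QuotientGroup.eq_one_iff _).1 h1
  rw [← mk_refl, ← mk_symm, Path.refl_symm, mk_refl] at h2
  rwa [trans_refl] at h2

end PointedNormalCover

theorem ker_shapeHom {X : Type u} [TopologicalSpace X] [ConnectedSpace X]
    [LocallyPathConnectedSpace X] [ParacompactSpace X] [T2Space X] (x : X) :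
    (shapeHom X x).ker = spanierGroup X x := by
  have : PathConnectedSpace X := .of_locallyPathConnectedSpace
  refine le_antisymm (fun g hg => ?_) fun g hg => ?_
  · simp only [spanierGroup, Subgroup.mem_iInf]
    rintro 𝒰 ⟨ho, hc⟩
    obtain ⟨𝒱, hpc, hun⟩ := exists_pointedNormalCover x ho hc
    exact 𝒱.ker_canonicalHom_le hpc hun (congrFun (congrArg Subtype.val hg) 𝒱)
  · exact Subtype.ext (funext fun 𝒰 => 𝒰.spanierGroup_le_ker_canonicalHom hg)

end

theorem proposition5p8 {X : Type*} [TopologicalSpace X] [ConnectedSpace X]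
    [LocallyPathConnectedSpace X] [ParacompactSpace X] [T2Space X] (x : X) :
    (spanierGroup X x = ⊥ ↔ Function.Injective (shapeHom X x)) ∧
      (spanierGroup X x = ⊥ ↔ ShapeInjective X) := by
  have : PathConnectedSpace X := .of_locallyPathConnectedSpace
  have key : ∀ y : X, spanierGroup X y = ⊥ ↔ Function.Injective (shapeHom X y) := fun y => by
    rw [← MonoidHom.ker_eq_bot_iff, ker_shapeHom]
  exact ⟨key x, fun h y => (key y).1
    (spanierGroup_eq_bot_of_path (PathConnectedSpace.somePath y x) h), fun h => (key x).2 (h x)⟩
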